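/- All objects are smooth ($C^\infty$). Let $h,k\ge 0$ be integers and let $M$ be a $(2h+2k+2)$-dimensional manifold (without boundary, Hausdorff, second countable). For a one-form $\alpha$ the exterior derivative is normalized by $d\alpha(X,Y)=\tfrac12\bigl(X(\alpha(Y))-Y(\alpha(X))-\alpha([X,Y])\bigr)$. A *contact pair* of type $(h,k)$ on $M$ is a pair of one-forms $(\alpha_1,\alpha_2)$ such that $\alpha_1\wedge(d\alpha_1)^h\wedge\alpha_2\wedge(d\alpha_2)^k$ is a volume form, $(d\alpha_1)^{h+1}=0$ and $(d\alpha_2)^{k+1}=0$. Its *Reeb vector fields* $Z_1,Z_2$ are the vector fields determined by $\alpha_i(Z_j)=\delta_{ij}$ and $i_{Z_j}d\alpha_i=0$ for $i,j=1,2$. A *metric contact pair* (MCP) is a quadruple $(\alpha_1,\alpha_2,\phi,g)$, where $(\alpha_1,\alpha_2)$ is a contact pair, $\phi$ is a $(1,1)$-tensor field with $\phi^2=-\mathrm{Id}+\alpha_1\otimes Z_1+\alpha_2\otimes Z_2$ and $\phi Z_1=\phi Z_2=0$, and $g$ is a Riemannian metric with $g(X,\phi Y)=(d\alpha_1+d\alpha_2)(X,Y)$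 and $g(X,Z_i)=\alpha_i(X)$ for $i=1,2$ and all $X,Y$. The endomorphism $\phi$ is *decomposable* if it maps $\ker\alpha_i\cap\ker d\alpha_i$ into itself for $i=1,2$. Let $\nabla$ be the Levi-Civita connection of $g$, $R_{XY}W=\nabla_X\nabla_YW-\nabla_Y\nabla_XW-\nabla_{[X,Y]}W$ its curvature, and $K(X,Y)=\dfrac{g(R_{XY}Y,X)}{g(X,X)g(Y,Y)-g(X,Y)^2}$ the sectional curvature of the plane spanned by linearly independent $X,Y$. **Theorem.** Let $(\alpha_1,\alpha_2,\phi,g)$ be an MCP of type $(h,k)$ with decomposable $\phi$ on $M$, with Reeb vector fields $Z_1,Z_2$, and let $Z=Z_1+Z_2$. Then $Z$ is Killing (that is, $\mathcal L_Zg=0$) if and only if, at every point of $M$, $K(X,Z)=\tfrac12$ for every nonzero tangent vector $X$ orthogonal to both $Z_1$ and $Z_2$. Moreover, in this case, for every vector field $Y$, $$R_{YZ}Z=Y-\alpha_1(Y)Z_1-\alpha_2(Y)Z_2 .$$ -/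

import Mathlib

open Bundle VectorField NormedSpace
open scoped Manifold ContDiff

noncomputable section

/-! ### Exterior algebra on a real vector space -/

section Algebra

variable {V : Type*} [AddCommGroup V] [Module ℝ V]

/-- The wedge product of two alternating forms, as a sum over shuffles. -/
def wedge {m n : ℕ} (β : V [⋀^Fin m]→ₗ[ℝ] ℝ) (γ : V [⋀^Fin n]→ₗ[ℝ] ℝ) :
    V [⋀^Fin (m + n)]→ₗ[ℝ] ℝ :=
  ((LinearMap.mul' ℝ ℝ).compAlternatingMap (β.domCoprod γ)).domDomCongr finSumFinEquiv

/-- The exterior power `β ∧ ⋯ ∧ β` (`n` factors) of a two-form. -/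
def wedgePow (β : V [⋀^Fin 2]→ₗ[ℝ] ℝ) : (n : ℕ) → V [⋀^Fin (2 * n)]→ₗ[ℝ] ℝ
  | 0 => haveI : IsEmpty (Fin (2 * 0)) := Fin.isEmpty
    AlternatingMap.constOfIsEmpty ℝ V (Fin (2 * 0)) (1 : ℝ)
  | n + 1 => wedge (wedgePow β n) β

/-- An alternating bilinear map as a two-form. -/
def twoForm (B : V →ₗ[ℝ] V →ₗ[ℝ] ℝ) (hB : ∀ v, B v v = 0) : V [⋀^Fin 2]→ₗ[ℝ] ℝ where
  toFun v := B (v 0) (v 1)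
  map_update_add' := by
    intro _ v i x y
    fin_cases i <;> simp
  map_update_smul' := by
    intro _ v i c x
    fin_cases i <;> simp
  map_eq_zero_of_eq' := by
    intro v i j hv hij
    have : v 0 = v 1 := by
      fin_cases i <;> fin_cases j <;> simp_all
    rw [this]
    exact hB _

end Algebra

variable {E : Type*} [NormedAddCommGroup E] [NormedSpace ℝ E] [FiniteDimensional ℝ E]
  {H : Type*} [TopologicalSpace H] (I : ModelWithCorners ℝ E H)
  (M : Type*) [TopologicalSpace M] [ChartedSpace H M] [IsManifold I ∞ M]

/-- Smooth vector fields. -/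
abbrev VecField : Type _ := Cₛ^∞⟮I; E, fun p : M ↦ TangentSpace I p⟯

/-- Smooth one-forms. -/
abbrev OneForm : Type _ := Cₛ^∞⟮I; E →L[ℝ] ℝ, fun p : M ↦ TangentSpace I p →L[ℝ] ℝ⟯

/-- Smooth tensor fields of type `(1,1)`, i.e. fields of endomorphisms of the tangent spaces. -/
abbrev EndField : Type _ :=
  Cₛ^∞⟮I; E →L[ℝ] E, fun p : M ↦ TangentSpace I p →L[ℝ] TangentSpace I p⟯

variable {I M}

/-! ### The exterior derivative of a one-form -/

section ExteriorDerivative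

/-- `½ (X(α(Y)) - Y(α(X)) - α([X, Y]))` at the point `p`. -/
def extDerivAux (α : OneForm I M) (X Y : Π p : M, TangentSpace I p) (p : M) : ℝ :=
  (1 / 2 : ℝ) * (d% (fun q ↦ α q (Y q)) p (X p) - d% (fun q ↦ α q (X q)) p (Y p)
    - α p (mlieBracket I X Y p))

theorem OneForm.mdifferentiableAt_apply (α : OneForm I M) {X : Π p : M, TangentSpace I p} {p : M}
    (hX : MDiffAt (T% X) p) : MDiffAt (fun q ↦ α q (X q)) p := by
  have h1 : MDifferentiableAt I (I.prod 𝓘(ℝ, E →L[ℝ] ℝ))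
      (fun q ↦ TotalSpace.mk' (E →L[ℝ] ℝ)
        (E := fun (q : M) ↦ (TangentSpace I q →L[ℝ] Bundle.Trivial M ℝ q)) q (α q)) p :=
    (α.contMDiff p).mdifferentiableAt (by simp)
  have := h1.clm_bundle_apply (F₁ := E) (F₂ := ℝ) hX
  simp only [mdifferentiableAt_totalSpace] at this
  exact this.2

theorem extDerivAux_swap (α : OneForm I M) (X Y : Π p : M, TangentSpace I p) (p : M) :
    extDerivAux α X Y p = - extDerivAux α Y X p := by
  unfold extDerivAux
  rw [mlieBracket_swap_apply, map_neg]
  ring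

theorem extDerivAux_tensorial₁ (α : OneForm I M) (p : M) (Y : Π p : M, TangentSpace I p)
    (_hY : MDiffAt (T% Y) p) : TensorialAt I E (extDerivAux α · Y p) p where
  smul := by
    intro f X hf hX
    have h : (fun q ↦ α q ((f • X) q)) = fun q ↦ f q * α q (X q) := by ext q; simp
    unfold extDerivAux
    rw [h, mvfderiv_fun_mul hf (α.mdifferentiableAt_apply hX), mlieBracket_smul_left hf hX]
    simp
    ring
  add := by
    intro X X' hX hX'
    have h : (fun q ↦ α q ((X + X') q)) = fun q ↦ α q (X q) + α q (X' q) := by ext q; simp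
    unfold extDerivAux
    rw [h, mvfderiv_fun_add (α.mdifferentiableAt_apply hX) (α.mdifferentiableAt_apply hX'),
      mlieBracket_add_left hX hX']
    simp
    ring

theorem extDerivAux_tensorial₂ (α : OneForm I M) (p : M) (X : Π p : M, TangentSpace I p)
    (hX : MDiffAt (T% X) p) : TensorialAt I E (extDerivAux α X · p) p where
  smul hf hY := by
    rw [extDerivAux_swap, (extDerivAux_tensorial₁ α p X hX).smul hf hY, extDerivAux_swap α X]
    simp
  add hY hY' := by
    rw [extDerivAux_swap, (extDerivAux_tensorial₁ α p X hX).add hY hY', extDerivAux_swap α X,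
      extDerivAux_swap α X]
    ring

/-- The exterior derivative of a one-form, with the normalization
`dα(X, Y) = ½ (X(α(Y)) - Y(α(X)) - α([X, Y]))`. -/
def OneForm.d (α : OneForm I M) (p : M) : TangentSpace I p →L[ℝ] TangentSpace I p →L[ℝ] ℝ :=
  TensorialAt.mkHom₂ (extDerivAux α · · p) p
    (extDerivAux_tensorial₁ α p) (extDerivAux_tensorial₂ α p)

theorem OneForm.d_apply (α : OneForm I M) {X Y : Π p : M, TangentSpace I p} {p : M}
    (hX : MDiffAt (T% X) p) (hY : MDiffAt (T% Y) p) :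
    α.d p (X p) (Y p) = (1 / 2 : ℝ) * (d% (fun q ↦ α q (Y q)) p (X p)
      - d% (fun q ↦ α q (X q)) p (Y p) - α p (mlieBracket I X Y p)) :=
  TensorialAt.mkHom₂_apply _ _ hX hY

theorem OneForm.d_self (α : OneForm I M) (p : M) (v : TangentSpace I p) : α.d p v v = 0 := by
  unfold OneForm.d
  rw [TensorialAt.mkHom₂_apply_eq_extend]
  have := extDerivAux_swap α (FiberBundle.extend E v) (FiberBundle.extend E v) p
  linarith

/-- The value of `α` at `p`, as an alternating form of degree one. -/
def OneForm.form (α : OneForm I M) (p : M) : TangentSpace I p [⋀^Fin 1]→ₗ[ℝ] ℝ :=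
  AlternatingMap.ofSubsingleton ℝ (TangentSpace I p) ℝ (0 : Fin 1) (α p : TangentSpace I p →ₗ[ℝ] ℝ)

/-- The value of `dα` at `p`, as an alternating form of degree two. -/
def OneForm.dForm (α : OneForm I M) (p : M) : TangentSpace I p [⋀^Fin 2]→ₗ[ℝ] ℝ :=
  twoForm (ContinuousLinearMap.coeLM ℝ ∘ₗ (α.d p).toLinearMap) (α.d_self p)

end ExteriorDerivative

/-! ### The Levi-Civita connection, curvature and Killing fields -/

section Riemannian

variable [RiemannianBundle (fun p : M ↦ TangentSpace I p)]

variable (I) in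
/-- The right-hand side of the Koszul formula. -/
def koszul (X Y W : Π p : M, TangentSpace I p) (p : M) : ℝ :=
  (1 / 2 : ℝ) * (d% (fun q ↦ inner ℝ (Y q) (W q)) p (X p)
    + d% (fun q ↦ inner ℝ (W q) (X q)) p (Y p)
    - d% (fun q ↦ inner ℝ (X q) (Y q)) p (W p)
    + inner ℝ (mlieBracket I X Y p) (W p)
    - inner ℝ (mlieBracket I Y W p) (X p)
    + inner ℝ (mlieBracket I W X p) (Y p))

variable [IsContMDiffRiemannianBundle I ∞ E (fun p : M ↦ TangentSpace I p)]

theorem mdifferentiableAt_inner {p : M} {X Y : Π p : M, TangentSpace I p}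
    (hX : MDiffAt (T% X) p) (hY : MDiffAt (T% Y) p) :
    MDiffAt (fun q ↦ inner ℝ (X q) (Y q)) p :=
  MDifferentiableAt.inner_bundle (IB := I) (F := E) (E := fun p : M ↦ TangentSpace I p)
    (b := id) (v := X) (w := Y) hX hY

theorem koszul_tensorial₁ {p : M} {Y : Π p : M, TangentSpace I p} (hY : MDiffAt (T% Y) p)
    (W : Π p : M, TangentSpace I p) (hW : MDiffAt (T% W) p) :
    TensorialAt I E (koszul I · Y W p) p where
  smul := by
    intro f X hf hX
    have h1 : (fun q ↦ inner ℝ (W q) ((f • X) q)) = fun q ↦ f q * inner ℝ (W q) (X q) := by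
      ext q; simp [inner_smul_right]
    have h2 : (fun q ↦ inner ℝ ((f • X) q) (Y q)) = fun q ↦ f q * inner ℝ (X q) (Y q) := by
      ext q; simp [inner_smul_left]
    unfold koszul
    rw [h1, h2, mvfderiv_fun_mul hf (mdifferentiableAt_inner hW hX), mvfderiv_fun_mul hf (mdifferentiableAt_inner hX hY),
      mlieBracket_smul_left hf hX, mlieBracket_smul_right hf hX]
    simp [inner_add_left, inner_smul_left, inner_smul_right, real_inner_comm]
    ring
  add := by
    intro X X' hX hX'
    have h1 : (fun q ↦ inner ℝ (W q) ((X + X') q))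
        = fun q ↦ inner ℝ (W q) (X q) + inner ℝ (W q) (X' q) := by
      ext q; simp [inner_add_right]
    have h2 : (fun q ↦ inner ℝ ((X + X') q) (Y q))
        = fun q ↦ inner ℝ (X q) (Y q) + inner ℝ (X' q) (Y q) := by
      ext q; simp [inner_add_left]
    unfold koszul
    rw [h1, h2, mvfderiv_fun_add (mdifferentiableAt_inner hW hX) (mdifferentiableAt_inner hW hX'),
      mvfderiv_fun_add (mdifferentiableAt_inner hX hY) (mdifferentiableAt_inner hX' hY),
      mlieBracket_add_left hX hX', mlieBracket_add_right hX hX']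
    simp [inner_add_left, inner_add_right]
    ring

theorem koszul_tensorial₃ {p : M} {Y : Π p : M, TangentSpace I p} (hY : MDiffAt (T% Y) p)
    (X : Π p : M, TangentSpace I p) (hX : MDiffAt (T% X) p) :
    TensorialAt I E (koszul I X Y · p) p where
  smul := by
    intro f W hf hW
    have h1 : (fun q ↦ inner ℝ ((f • W) q) (X q)) = fun q ↦ f q * inner ℝ (W q) (X q) := by
      ext q; simp [inner_smul_left]
    have h2 : (fun q ↦ inner ℝ (Y q) ((f • W) q)) = fun q ↦ f q * inner ℝ (Y q) (W q) := by
      ext q; simp [inner_smul_right]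
    unfold koszul
    rw [h1, h2, mvfderiv_fun_mul hf (mdifferentiableAt_inner hW hX), mvfderiv_fun_mul hf (mdifferentiableAt_inner hY hW),
      mlieBracket_smul_left hf hW, mlieBracket_smul_right hf hW]
    simp [inner_add_left, inner_smul_left, inner_smul_right, real_inner_comm]
    ring
  add := by
    intro W W' hW hW'
    have h1 : (fun q ↦ inner ℝ ((W + W') q) (X q))
        = fun q ↦ inner ℝ (W q) (X q) + inner ℝ (W' q) (X q) := by
      ext q; simp [inner_add_left]
    have h2 : (fun q ↦ inner ℝ (Y q) ((W + W') q))
        = fun q ↦ inner ℝ (Y q) (W q) + inner ℝ (Y q) (W' q) := by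
      ext q; simp [inner_add_right]
    unfold koszul
    rw [h1, h2, mvfderiv_fun_add (mdifferentiableAt_inner hW hX) (mdifferentiableAt_inner hW' hX),
      mvfderiv_fun_add (mdifferentiableAt_inner hY hW) (mdifferentiableAt_inner hY hW'),
      mlieBracket_add_left hW hW', mlieBracket_add_right hW hW']
    simp [inner_add_left, inner_add_right]
    ring

theorem koszul_add {p : M} {X Y Y' W : Π p : M, TangentSpace I p} (hX : MDiffAt (T% X) p)
    (hY : MDiffAt (T% Y) p) (hY' : MDiffAt (T% Y') p) (hW : MDiffAt (T% W) p) :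
    koszul I X (Y + Y') W p = koszul I X Y W p + koszul I X Y' W p := by
  have h1 : (fun q ↦ inner ℝ ((Y + Y') q) (W q))
      = fun q ↦ inner ℝ (Y q) (W q) + inner ℝ (Y' q) (W q) := by
    ext q; simp [inner_add_left]
  have h2 : (fun q ↦ inner ℝ (X q) ((Y + Y') q))
      = fun q ↦ inner ℝ (X q) (Y q) + inner ℝ (X q) (Y' q) := by
    ext q; simp [inner_add_right]
  unfold koszul
  rw [h1, h2, mvfderiv_fun_add (mdifferentiableAt_inner hY hW) (mdifferentiableAt_inner hY' hW),
    mvfderiv_fun_add (mdifferentiableAt_inner hX hY) (mdifferentiableAt_inner hX hY'),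
    mlieBracket_add_left hY hY', mlieBracket_add_right hY hY']
  simp [inner_add_left, inner_add_right]
  ring

theorem koszul_smul {p : M} {f : M → ℝ} {X Y W : Π p : M, TangentSpace I p} (hf : MDiffAt f p)
    (hX : MDiffAt (T% X) p) (hY : MDiffAt (T% Y) p) (hW : MDiffAt (T% W) p) :
    koszul I X (f • Y) W p = f p * koszul I X Y W p + d% f p (X p) * inner ℝ (Y p) (W p) := by
  have h1 : (fun q ↦ inner ℝ ((f • Y) q) (W q)) = fun q ↦ f q * inner ℝ (Y q) (W q) := by
    ext q; simp [inner_smul_left]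
  have h2 : (fun q ↦ inner ℝ (X q) ((f • Y) q)) = fun q ↦ f q * inner ℝ (X q) (Y q) := by
    ext q; simp [inner_smul_right]
  unfold koszul
  rw [h1, h2, mvfderiv_fun_mul hf (mdifferentiableAt_inner hY hW), mvfderiv_fun_mul hf (mdifferentiableAt_inner hX hY),
    mlieBracket_smul_left hf hY, mlieBracket_smul_right hf hY]
  simp [inner_add_left, inner_smul_left, inner_smul_right, real_inner_comm]
  ring

instance tangentSpace_finiteDimensional (p : M) : FiniteDimensional ℝ (TangentSpace I p) :=
  inferInstanceAs (FiniteDimensional ℝ E)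

open Classical in
/-- The covariant derivative `v ↦ ∇_v Y` at `p`: the vector `∇_v Y` represents, through the metric,
the linear form given by the Koszul formula. If `Y` is not differentiable at `p`, it is `0`. -/
def leviCivitaFun (Y : Π p : M, TangentSpace I p) (p : M) :
    TangentSpace I p →L[ℝ] TangentSpace I p :=
  if hY : MDiffAt (T% Y) p then
    LinearMap.toContinuousLinearMap
      { toFun := fun v ↦ (InnerProductSpace.toDual ℝ (TangentSpace I p)).symm
          (TensorialAt.mkHom₂ (koszul I · Y · p) p (koszul_tensorial₁ hY) (koszul_tensorial₃ hY) v)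
        map_add' := by intro v w; simp
        map_smul' := by intro c v; simp }
  else 0

/-- The Koszul formula. -/
theorem inner_leviCivitaFun {p : M} {X Y W : Π p : M, TangentSpace I p} (hX : MDiffAt (T% X) p)
    (hY : MDiffAt (T% Y) p) (hW : MDiffAt (T% W) p) :
    inner ℝ (leviCivitaFun Y p (X p)) (W p) = koszul I X Y W p := by
  have h := TensorialAt.mkHom₂_apply (koszul_tensorial₁ hY) (koszul_tensorial₃ hY) hX hW
  rw [leviCivitaFun, dif_pos hY]
  simpa using h

theorem eq_of_koszul {p : M} {u v : TangentSpace I p}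
    (h : ∀ W : Π p : M, TangentSpace I p, MDiffAt (T% W) p → inner ℝ u (W p) = inner ℝ v (W p)) :
    u = v := by
  refine ext_inner_right ℝ fun w ↦ ?_
  simpa using h (FiberBundle.extend E w) (FiberBundle.mdifferentiableAt_extend I E w)

variable (I M) in
/-- The Levi-Civita connection of the metric; `leviCivita I M Y p (X p)` is `∇_X Y` at `p`. -/
def leviCivita : CovariantDerivative I E (fun p : M ↦ TangentSpace I p) where
  toFun := leviCivitaFun
  isCovariantDerivativeOnUniv :=
    { add := by
        intro Y Y' p hY hY' _
        ext1 v
        refine eq_of_koszul fun W hW ↦ ?_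
        have hX := FiberBundle.mdifferentiableAt_extend I E v
        have hv : v = FiberBundle.extend E v p := by simp
        rw [hv, inner_leviCivitaFun hX (mdifferentiableAt_add_section hY hY') hW,
          ContinuousLinearMap.add_apply, inner_add_left, inner_leviCivitaFun hX hY hW,
          inner_leviCivitaFun hX hY' hW, koszul_add hX hY hY' hW]
      leibniz := by
        intro Y f p hY hf _
        ext1 v
        refine eq_of_koszul fun W hW ↦ ?_
        have hX := FiberBundle.mdifferentiableAt_extend I E v
        have hv : v = FiberBundle.extend E v p := by simp
        rw [hv, inner_leviCivitaFun hX (hf.smul_section hY) hW, koszul_smul hf hX hY hW,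
          ContinuousLinearMap.add_apply, inner_add_left, ContinuousLinearMap.smul_apply,
          inner_smul_left, inner_leviCivitaFun hX hY hW, ContinuousLinearMap.smulRight_apply,
          inner_smul_left]
        simp }

theorem inner_leviCivita {p : M} {X Y W : Π p : M, TangentSpace I p} (hX : MDiffAt (T% X) p)
    (hY : MDiffAt (T% Y) p) (hW : MDiffAt (T% W) p) :
    inner ℝ (leviCivita I M Y p (X p)) (W p) = koszul I X Y W p :=
  inner_leviCivitaFun hX hY hW

/-- The Levi-Civita connection has no torsion. -/
theorem leviCivita_torsion {p : M} {X Y : Π p : M, TangentSpace I p} (hX : MDiffAt (T% X) p)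
    (hY : MDiffAt (T% Y) p) :
    leviCivita I M Y p (X p) - leviCivita I M X p (Y p) = mlieBracket I X Y p := by
  refine eq_of_koszul fun W hW ↦ ?_
  rw [inner_sub_left, inner_leviCivita hX hY hW, inner_leviCivita hY hX hW]
  unfold koszul
  rw [mlieBracket_swap_apply (V := Y) (W := X), mlieBracket_swap_apply (V := X) (W := W),
    mlieBracket_swap_apply (V := Y) (W := W)]
  simp only [inner_neg_left, real_inner_comm]
  ring

/-- The Levi-Civita connection is compatible with the metric. -/
theorem leviCivita_metric {p : M} {X Y W : Π p : M, TangentSpace I p} (hX : MDiffAt (T% X) p)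
    (hY : MDiffAt (T% Y) p) (hW : MDiffAt (T% W) p) :
    d% (fun q ↦ inner ℝ (Y q) (W q)) p (X p)
      = inner ℝ (leviCivita I M Y p (X p)) (W p) + inner ℝ (Y p) (leviCivita I M W p (X p)) := by
  rw [real_inner_comm _ (Y p), inner_leviCivita hX hY hW, inner_leviCivita hX hW hY]
  unfold koszul
  rw [mlieBracket_swap_apply (V := W) (W := Y), mlieBracket_swap_apply (V := X) (W := W),
    mlieBracket_swap_apply (V := Y) (W := X)]
  simp only [inner_neg_left, real_inner_comm]
  ring

/-- The curvature `R_{XY} W = ∇_X ∇_Y W - ∇_Y ∇_X W - ∇_{[X, Y]} W`. -/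
def curvature (X Y W : VecField I M) (p : M) : TangentSpace I p :=
  leviCivita I M (fun q ↦ leviCivita I M W q (Y q)) p (X p)
    - leviCivita I M (fun q ↦ leviCivita I M W q (X q)) p (Y p)
    - leviCivita I M W p (mlieBracket I X Y p)

/-- The sectional curvature at `p` of the plane spanned by `X p` and `Y p`,
which have to be linearly independent. -/
def sectionalCurvature (X Y : VecField I M) (p : M) : ℝ :=
  inner ℝ (curvature X Y Y p) (X p)
    / (inner ℝ (X p) (X p) * inner ℝ (Y p) (Y p) - inner ℝ (X p) (Y p) ^ 2)

/-- `Z` is a Killing field: the Lie derivative of the metric along `Z` vanishes. -/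
def IsKilling (Z : VecField I M) : Prop :=
  ∀ (X Y : VecField I M) (p : M),
    d% (fun q ↦ inner ℝ (X q) (Y q)) p (Z p)
      - inner ℝ (mlieBracket I Z X p) (Y p) - inner ℝ (X p) (mlieBracket I Z Y p) = 0

end Riemannian

/-! ### Contact pairs -/

section ContactPair

/-- `(α₁, α₂)` is a contact pair of type `(h, k)` on a manifold of dimension `2h + 2k + 2`:
`α₁ ∧ (dα₁)^h ∧ α₂ ∧ (dα₂)^k` is a volume form, `(dα₁)^(h+1) = 0` and `(dα₂)^(k+1) = 0`. -/
structure IsContactPair (h k : ℕ) (α₁ α₂ : OneForm I M) : Prop where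
  dim : Module.finrank ℝ E = 2 * h + 2 * k + 2
  volume : ∀ p, wedge (wedge (wedge (α₁.form p) (wedgePow (α₁.dForm p) h)) (α₂.form p))
    (wedgePow (α₂.dForm p) k) ≠ 0
  pow₁ : ∀ p, wedgePow (α₁.dForm p) (h + 1) = 0
  pow₂ : ∀ p, wedgePow (α₂.dForm p) (k + 1) = 0

/-- `Z₁` and `Z₂` are the Reeb vector fields of `(α₁, α₂)`. -/
structure IsReebPair (α₁ α₂ : OneForm I M) (Z₁ Z₂ : VecField I M) : Prop where
  apply₁₁ : ∀ p, α₁ p (Z₁ p) = 1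
  apply₂₂ : ∀ p, α₂ p (Z₂ p) = 1
  apply₁₂ : ∀ p, α₁ p (Z₂ p) = 0
  apply₂₁ : ∀ p, α₂ p (Z₁ p) = 0
  contract₁₁ : ∀ p, α₁.d p (Z₁ p) = 0
  contract₂₁ : ∀ p, α₂.d p (Z₁ p) = 0
  contract₁₂ : ∀ p, α₁.d p (Z₂ p) = 0
  contract₂₂ : ∀ p, α₂.d p (Z₂ p) = 0

/-- `(α₁, α₂, φ)` is a contact pair structure of type `(h, k)` with Reeb vector fields `Z₁, Z₂`. -/
structure IsContactPairStructure (h k : ℕ) (α₁ α₂ : OneForm I M) (φ : EndField I M)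
    (Z₁ Z₂ : VecField I M) : Prop where
  contactPair : IsContactPair h k α₁ α₂
  reeb : IsReebPair α₁ α₂ Z₁ Z₂
  sq : ∀ p v, φ p (φ p v) = -v + α₁ p v • Z₁ p + α₂ p v • Z₂ p
  map_reeb₁ : ∀ p, φ p (Z₁ p) = 0
  map_reeb₂ : ∀ p, φ p (Z₂ p) = 0

/-- `(α₁, α₂, φ, g)` is a metric contact pair of type `(h, k)` with Reeb vector fields `Z₁, Z₂`,
where `g` is the given metric on the tangent bundle: `(α₁, α₂, φ)` is a contact pair structure
and `g` is an associated metric. -/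
structure IsMetricContactPair [RiemannianBundle (fun p : M ↦ TangentSpace I p)] (h k : ℕ)
    (α₁ α₂ : OneForm I M) (φ : EndField I M) (Z₁ Z₂ : VecField I M) : Prop where
  toContactPairStructure : IsContactPairStructure h k α₁ α₂ φ Z₁ Z₂
  inner_map : ∀ p v w, inner ℝ v (φ p w) = α₁.d p v w + α₂.d p v w
  inner_reeb₁ : ∀ p (v : TangentSpace I p), inner ℝ v (Z₁ p) = α₁ p v
  inner_reeb₂ : ∀ p (v : TangentSpace I p), inner ℝ v (Z₂ p) = α₂ p v

/-- The tangent space `ker α ∩ ker dα` of the characteristic foliation of `α`. -/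
def charSpace (α : OneForm I M) (p : M) : Submodule ℝ (TangentSpace I p) :=
  LinearMap.ker (α p).toLinearMap ⊓ LinearMap.ker (α.d p).toLinearMap

/-- `φ` preserves the tangent spaces of the characteristic foliations of `α₁` and `α₂`. -/
def IsDecomposable (α₁ α₂ : OneForm I M) (φ : EndField I M) : Prop :=
  ∀ p, (∀ v ∈ charSpace α₁ p, φ p v ∈ charSpace α₁ p) ∧
    (∀ v ∈ charSpace α₂ p, φ p v ∈ charSpace α₂ p)

end ContactPair

end

/-!
Let `Z = Z₁ + Z₂` and `B = ∇Z + φ`. Since `Z` is metrically dual to `α₁ + α₂` and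
`g(X, φ Y) = (dα₁ + dα₂)(X, Y)`, the antisymmetric part of `∇Z` is `-φ`; so `B` is symmetric,
`L_Z g = 2 g(B ·, ·)`, and `Z` is Killing if and only if `B = 0`
(`IsMetricContactPair.isKilling_iff`).

The Reeb conditions give `L_Z αᵢ = 0`, hence `L_Z dαᵢ = 0` and `[Z₁, Z₂] = 0`. Differentiating
`g(X, φ Y) = (dα₁ + dα₂)(X, Y)` and `φ² = -Id + α₁ ⊗ Z₁ + α₂ ⊗ Z₂` along `Z` then yields
`L_Z φ = -2 B φ`, `B Zᵢ = 0` and `φ B φ = B`. In particular `2 B X = φ (φ [Z, X] - [Z, φ X])`, so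
`∇_X Z = B X - φ X` is smooth, without any appeal to smoothness of the Levi-Civita connection.

As `∇_Z Z = 0`, the Jacobi operator is `R_{XZ} Z = -[Z, ∇_X Z] - ∇_{∇_X Z} Z + ∇_{[Z, X]} Z`, that is
`ℓ = -φ² - B² - 2 B φ - L_Z B`. If `B = 0`, this is `-φ²`, which gives the formula for the curvature
and the value `1/2` of the sectional curvatures. In general the term `L_Z B` cancels in
`ℓ - φ ℓ φ = -2 φ² - 2 B²` (`IsMetricContactPair.curvature_reeb_sub_map`). If the sectional curvatures
of the planes spanned by `Z` and `X`, and by `Z` and `φ X`, are `1/2`, where `X` is orthogonal to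
`Z₁` and `Z₂`, then taking the inner product with `X` leaves `|B X|² = 0`; therefore `B = 0`.
-/

noncomputable section

variable {E : Type*} [NormedAddCommGroup E] [NormedSpace ℝ E] [FiniteDimensional ℝ E]
  {H : Type*} [TopologicalSpace H] {I : ModelWithCorners ℝ E H}
  {M : Type*} [TopologicalSpace M] [ChartedSpace H M] [IsManifold I ∞ M]

/-! ### Calculus of smooth vector fields and one-forms -/

theorem VecField.mdifferentiableAt (X : VecField I M) (p : M) :
    MDiffAt (T% (⇑X : Π q : M, TangentSpace I q)) p :=
  (X.contMDiff p).mdifferentiableAt (by simp)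

/-- The Lie bracket of two smooth vector fields, as a smooth vector field. -/
def VecField.bracket (X Y : VecField I M) : VecField I M where
  toFun := mlieBracket I X Y
  contMDiff_toFun p := by
    have : IsManifold I (minSmoothness ℝ 2) M := by simp; infer_instance
    have : IsManifold I (((⊤ : ℕ∞) : ℕ∞ω) + 1) M := inferInstanceAs (IsManifold I ∞ M)
    exact ContMDiffAt.mlieBracket_vectorField (n := ⊤) (m := ⊤) (X.contMDiff p) (Y.contMDiff p)
      (by simp)

@[simp]
theorem VecField.bracket_apply (X Y : VecField I M) (p : M) :
    X.bracket Y p = mlieBracket I X Y p := rfl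

/-- The vector field `φ X`. -/
def EndField.app (φ : EndField I M) (X : VecField I M) : VecField I M where
  toFun p := φ p (X p)
  contMDiff_toFun := ContMDiff.clm_bundle_apply (F₁ := E) (F₂ := E) φ.contMDiff X.contMDiff

@[simp]
theorem EndField.app_apply (φ : EndField I M) (X : VecField I M) (p : M) :
    φ.app X p = φ p (X p) := rfl

theorem OneForm.contMDiff_apply (α : OneForm I M) (X : VecField I M) :
    ContMDiff I 𝓘(ℝ, ℝ) ∞ (fun p ↦ α p (X p)) := by
  have h1 : ContMDiff I (I.prod 𝓘(ℝ, E →L[ℝ] ℝ)) ∞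
      (fun q ↦ TotalSpace.mk' (E →L[ℝ] ℝ)
        (E := fun (q : M) ↦ (TangentSpace I q →L[ℝ] Bundle.Trivial M ℝ q)) q (α q)) :=
    α.contMDiff
  have := h1.clm_bundle_apply (F₁ := E) (F₂ := ℝ) X.contMDiff
  intro p
  have := this p
  simp only [contMDiffAt_totalSpace] at this
  exact this.2

/-- The product of a smooth function and a smooth vector field. -/
def VecField.fsmul (f : M → ℝ) (hf : ContMDiff I 𝓘(ℝ, ℝ) ∞ f) (X : VecField I M) :
    VecField I M where
  toFun := f • ⇑X
  contMDiff_toFun := hf.smul_section X.contMDiff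

/-- A tangent vector extends to a smooth vector field on the whole manifold. -/
theorem exists_vecField_apply_eq [T2Space M] [SecondCountableTopology M] (p : M)
    (v : TangentSpace I p) : ∃ X : VecField I M, X p = v := by
  have : LocallyCompactSpace M := Manifold.locallyCompact_of_finiteDimensional I
  classical
  let t : ∀ q : M, Set (TangentSpace I q) := fun q ↦ {w | ∀ h : q = p, w = h ▸ v}
  have ht : ∀ q, Convex ℝ (t q) := by
    intro q
    by_cases h : q = p
    · subst h
      simp [t]
    · have : t q = Set.univ := by ext; simp [t, h]
      rw [this]; exact convex_univ
  obtain ⟨X, hX⟩ := exists_contMDiffSection_forall_mem_convex_of_local (n := ⊤) (F_fiber := E)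
    I (fun q : M ↦ TangentSpace I q) t ht (fun q ↦ by
      by_cases h : q = p
      · subst h
        obtain ⟨s, hs, hs'⟩ := FiberBundle.exists_contMDiffOn_extend (k := ∞) I E v
        refine ⟨s, hs, FiberBundle.extend E v, hs', fun y hy h ↦ ?_⟩
        subst h
        simp
      · refine ⟨{p}ᶜ, isOpen_compl_singleton.mem_nhds h, fun _ ↦ 0, ?_, fun y hy h ↦ absurd h hy⟩
        exact (contMDiff_zeroSection ℝ (fun q : M ↦ TangentSpace I q)).contMDiffOn)
  exact ⟨X, hX p rfl⟩

theorem VecField.contMDiff_mvfderiv {f : M → ℝ} (hf : ContMDiff I 𝓘(ℝ, ℝ) ∞ f)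
    (X : VecField I M) : ContMDiff I 𝓘(ℝ, ℝ) ∞ (fun p ↦ d% f p (X p)) := by
  have h := (hf.contMDiff_tangentMap (m := ∞) (by simp)).comp X.contMDiff
  intro p
  have := h p
  rw [contMDiffAt_totalSpace] at this
  simpa [tangentMap] using! this.2

/-- The Jacobi identity for smooth vector fields. -/
theorem VecField.jacobi (X Y W : VecField I M) (p : M) :
    mlieBracket I X (Y.bracket W) p
      = mlieBracket I (X.bracket Y) W p + mlieBracket I Y (X.bracket W) p := by
  have : IsManifold I (minSmoothness ℝ 3) M := by simp; infer_instance
  have h := fun V : VecField I M ↦ ((V.contMDiff p).of_le (m := minSmoothness ℝ 2)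
    (by simpa using! (WithTop.coe_le_coe.2 le_top : ((2 : ℕ∞) : ℕ∞ω) ≤ ∞)))
  exact leibniz_identity_mlieBracket_apply (h X) (h Y) (h W)

/-- The Lie bracket acts on functions as the commutator. This follows from the Jacobi identity for
`X`, `Y` and `f W`, where `W` is any vector field that does not vanish at the given point. -/
theorem mvfderiv_mlieBracket [T2Space M] [SecondCountableTopology M] {f : M → ℝ}
    (hf : ContMDiff I 𝓘(ℝ, ℝ) ∞ f) (X Y : VecField I M) (p : M) :
    d% f p (mlieBracket I X Y p)
      = d% (fun q ↦ d% f q (Y q)) p (X p) - d% (fun q ↦ d% f q (X q)) p (Y p) := by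
  rcases subsingleton_or_nontrivial (TangentSpace I p) with _ | _
  · simp [Subsingleton.elim (mlieBracket I X Y p) 0, Subsingleton.elim (X p) 0,
      Subsingleton.elim (Y p) 0]
  obtain ⟨w, hw⟩ := exists_ne (0 : TangentSpace I p)
  obtain ⟨W, rfl⟩ := exists_vecField_apply_eq p w
  have hfp : ∀ q, MDiffAt f q := fun q ↦ (hf q).mdifferentiableAt (by simp)
  have hder : ∀ (V : VecField I M) (q : M), MDiffAt (fun q ↦ d% f q (V q)) q :=
    fun V q ↦ (V.contMDiff_mvfderiv hf q).mdifferentiableAt (by simp)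
  have key : ∀ U V : VecField I M, mlieBracket I U (V.bracket (W.fsmul f hf)) p
      = d% f p (V p) • mlieBracket I U W p + d% (fun q ↦ d% f q (V q)) p (U p) • W p
        + (f p • mlieBracket I U (V.bracket W) p + d% f p (U p) • mlieBracket I V W p) := by
    intro U V
    have h1 : ⇑(V.bracket (W.fsmul f hf))
        = (fun q ↦ d% f q (V q)) • ⇑W + f • ⇑(V.bracket W) := by
      ext1 q
      exact mlieBracket_smul_right (hfp q) (W.mdifferentiableAt q)
    rw [h1, mlieBracket_add_right ((hder V p).smul_section (W.mdifferentiableAt p))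
      ((hfp p).smul_section ((V.bracket W).mdifferentiableAt p)),
      mlieBracket_smul_right (hder V p) (W.mdifferentiableAt p),
      mlieBracket_smul_right (hfp p) ((V.bracket W).mdifferentiableAt p)]
    simp only [VecField.bracket_apply]
    abel
  have hJ := VecField.jacobi X Y (W.fsmul f hf) p
  have h2 : mlieBracket I (X.bracket Y) (W.fsmul f hf) p
      = d% f p (mlieBracket I X Y p) • W p + f p • mlieBracket I (X.bracket Y) W p :=
    mlieBracket_smul_right (hfp p) (W.mdifferentiableAt p)
  rw [key, key, h2, VecField.jacobi X Y W p] at hJ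
  have h3 : (d% f p (mlieBracket I X Y p) - (d% (fun q ↦ d% f q (Y q)) p (X p)
      - d% (fun q ↦ d% f q (X q)) p (Y p))) • W p = 0 := by
    rw [← sub_eq_zero, ← neg_eq_zero] at hJ
    rw [← hJ]
    module
  rcases smul_eq_zero.1 h3 with h4 | h4
  · linarith
  · exact absurd h4 hw

theorem OneForm.mdifferentiableAt_vecField (α : OneForm I M) (X : VecField I M) (p : M) :
    MDiffAt (fun q ↦ α q (X q)) p :=
  α.mdifferentiableAt_apply (X.mdifferentiableAt p)

theorem OneForm.d_vecField (α : OneForm I M) (X Y : VecField I M) (p : M) :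
    2 * α.d p (X p) (Y p) = d% (fun q ↦ α q (Y q)) p (X p)
      - d% (fun q ↦ α q (X q)) p (Y p) - α p (mlieBracket I X Y p) := by
  rw [α.d_apply (X.mdifferentiableAt p) (Y.mdifferentiableAt p)]
  ring

theorem OneForm.d_swap (α : OneForm I M) (p : M) (v w : TangentSpace I p) :
    α.d p v w = - α.d p w v := by
  have := α.d_self p (v + w)
  simp only [map_add, add_apply, α.d_self] at this
  linarith

/-- Cartan's formula: if `α(Z)` is constant and `i_Z dα = 0`, then `L_Z α = 0`. -/
theorem OneForm.mvfderiv_apply_of_contract {α : OneForm I M} {Z : VecField I M} {c : ℝ}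
    (hc : ∀ p, α p (Z p) = c) (hd : ∀ p, α.d p (Z p) = 0) (Y : VecField I M) (p : M) :
    d% (fun q ↦ α q (Y q)) p (Z p) = α p (mlieBracket I Z Y p) := by
  have h := α.d_vecField Z Y p
  have h0 : (fun q ↦ α q (Z q)) = fun _ ↦ c := funext hc
  rw [hd, h0, mvfderiv_const] at h
  simp only [zero_apply] at h
  linarith

/-- If `L_Z α = 0`, then `L_Z dα = 0`. -/
theorem OneForm.mvfderiv_d [T2Space M] [SecondCountableTopology M] {α : OneForm I M}
    {Z : VecField I M}
    (hZ : ∀ (Y : VecField I M) p, d% (fun q ↦ α q (Y q)) p (Z p) = α p (mlieBracket I Z Y p))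
    (X Y : VecField I M) (p : M) :
    MDiffAt (fun q ↦ α.d q (X q) (Y q)) p ∧
    d% (fun q ↦ α.d q (X q) (Y q)) p (Z p)
      = α.d p (mlieBracket I Z X p) (Y p) + α.d p (X p) (mlieBracket I Z Y p) := by
  have hder : ∀ U V : VecField I M, MDiffAt (fun q ↦ d% (fun q ↦ α q (V q)) q (U q)) p :=
    fun U V ↦ (U.contMDiff_mvfderiv (α.contMDiff_apply V) p).mdifferentiableAt (by simp)
  have hbr := α.mdifferentiableAt_vecField (X.bracket Y) p
  have e : (fun q ↦ α.d q (X q) (Y q)) = (fun _ ↦ (1 / 2 : ℝ)) *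
      ((fun q ↦ d% (fun q ↦ α q (Y q)) q (X q)) - (fun q ↦ d% (fun q ↦ α q (X q)) q (Y q))
        - fun q ↦ α q (X.bracket Y q)) := by
    ext q
    have := α.d_vecField X Y q
    simp only [VecField.bracket_apply, Pi.mul_apply, Pi.sub_apply]
    linarith
  have hdiff := ((hder X Y).sub (hder Y X)).sub hbr
  rw [e]
  refine ⟨mdifferentiableAt_const.mul hdiff, ?_⟩
  have hZf : ∀ V : VecField I M,
      (fun q ↦ d% (fun q ↦ α q (V q)) q (Z q)) = fun q ↦ α q (Z.bracket V q) :=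
    fun V ↦ funext (hZ V)
  have cXY := mvfderiv_mlieBracket (α.contMDiff_apply Y) Z X p
  have cYX := mvfderiv_mlieBracket (α.contMDiff_apply X) Z Y p
  rw [hZf] at cXY cYX
  have dX := α.d_vecField (Z.bracket X) Y p
  have dY := α.d_vecField X (Z.bracket Y) p
  have hJ := congrArg (α p) (VecField.jacobi Z X Y p)
  have hb := hZ (X.bracket Y) p
  rw [map_add] at hJ
  rw [mvfderiv_mul mdifferentiableAt_const hdiff, mvfderiv_const,
    mvfderiv_sub ((hder X Y).sub (hder Y X)) hbr, mvfderiv_sub (hder X Y) (hder Y X)]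
  simp only [VecField.bracket_apply, add_apply, smul_apply, sub_apply, zero_apply, smul_eq_mul]
    at *
  linarith

/-! ### The covariant derivative of a vector field -/

section Riemannian

variable [RiemannianBundle (fun p : M ↦ TangentSpace I p)]
  [IsContMDiffRiemannianBundle I ∞ E (fun p : M ↦ TangentSpace I p)]

/-- The Lie derivative of the metric along `Z` is twice the symmetric part of `∇Z`. -/
theorem lieDeriv_inner (Z X Y : VecField I M) (p : M) :
    d% (fun q ↦ inner ℝ (X q) (Y q)) p (Z p)
      - inner ℝ (mlieBracket I Z X p) (Y p) - inner ℝ (X p) (mlieBracket I Z Y p)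
      = inner ℝ (leviCivita I M Z p (X p)) (Y p) + inner ℝ (X p) (leviCivita I M Z p (Y p)) := by
  rw [leviCivita_metric (Z.mdifferentiableAt p) (X.mdifferentiableAt p) (Y.mdifferentiableAt p),
    ← leviCivita_torsion (Z.mdifferentiableAt p) (X.mdifferentiableAt p),
    ← leviCivita_torsion (Z.mdifferentiableAt p) (Y.mdifferentiableAt p),
    inner_sub_left, inner_sub_right]
  ring

/-- If `α` is dual to `Z`, then `dα` is the antisymmetric part of `∇Z`. -/
theorem inner_leviCivita_sub_of_dual {α : OneForm I M} {Z : VecField I M}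
    (hα : ∀ p (v : TangentSpace I p), inner ℝ v (Z p) = α p v) (X Y : VecField I M) (p : M) :
    inner ℝ (leviCivita I M Z p (X p)) (Y p) - inner ℝ (X p) (leviCivita I M Z p (Y p))
      = 2 * α.d p (X p) (Y p) := by
  rw [α.d_vecField]
  simp only [← hα]
  rw [leviCivita_metric (X.mdifferentiableAt p) (Y.mdifferentiableAt p) (Z.mdifferentiableAt p),
    leviCivita_metric (Y.mdifferentiableAt p) (X.mdifferentiableAt p) (Z.mdifferentiableAt p),
    ← leviCivita_torsion (X.mdifferentiableAt p) (Y.mdifferentiableAt p), inner_sub_left,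
    real_inner_comm (Y p)]
  ring

/-- The curvature through `∇Z` and Lie brackets with `Z`: if `∇_Z Z = 0` and `A` is a vector field
with values `∇_X Z`, then `R_{XZ} Z = -[Z, A] - ∇_A Z + ∇_{[Z, X]} Z`. -/
theorem curvature_eq_of_geodesic {Z : VecField I M} (hZ : ∀ p, leviCivita I M Z p (Z p) = 0)
    {X A : VecField I M} (hA : ∀ p, leviCivita I M Z p (X p) = A p) (p : M) :
    curvature X Z Z p = -mlieBracket I Z A p - leviCivita I M Z p (A p)
      + leviCivita I M Z p (mlieBracket I Z X p) := by
  have h1 : (fun q ↦ leviCivita I M Z q (Z q)) = 0 := funext hZ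
  have h2 : (fun q ↦ leviCivita I M Z q (X q)) = ⇑A := funext hA
  rw [curvature, h1, h2, ← leviCivita_torsion (Z.mdifferentiableAt p) (A.mdifferentiableAt p),
    mlieBracket_swap_apply (V := X)]
  simp [(leviCivita I M).zero]

/-! ### Metric contact pairs -/

namespace IsMetricContactPair

variable {m n : ℕ} {α₁ α₂ : OneForm I M} {φ : EndField I M} {Z₁ Z₂ : VecField I M}

theorem sq (S : IsMetricContactPair m n α₁ α₂ φ Z₁ Z₂) (p : M) (v : TangentSpace I p) :
    φ p (φ p v) = -v + α₁ p v • Z₁ p + α₂ p v • Z₂ p :=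
  S.toContactPairStructure.sq p v

theorem inner_reeb (S : IsMetricContactPair m n α₁ α₂ φ Z₁ Z₂) (p : M) (v : TangentSpace I p) :
    inner ℝ v ((Z₁ + Z₂) p) = (α₁ + α₂) p v := by
  simp [inner_add_right, S.inner_reeb₁, S.inner_reeb₂]

theorem inner_map_left (S : IsMetricContactPair m n α₁ α₂ φ Z₁ Z₂) (p : M)
    (v w : TangentSpace I p) :
    inner ℝ (φ p v) w = -inner ℝ v (φ p w) := by
  rw [real_inner_comm, S.inner_map, S.inner_map, α₁.d_swap, α₂.d_swap]
  ring

/-- `L_Z α₁ = 0` for `Z = Z₁ + Z₂`. -/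
theorem mvfderiv_reeb₁ (S : IsMetricContactPair m n α₁ α₂ φ Z₁ Z₂) (Y : VecField I M) (p : M) :
    d% (fun q ↦ α₁ q (Y q)) p ((Z₁ + Z₂) p) = α₁ p (mlieBracket I (Z₁ + Z₂) Y p) := by
  have R := S.toContactPairStructure.reeb
  exact OneForm.mvfderiv_apply_of_contract (Z := Z₁ + Z₂) (c := 1)
    (fun q ↦ by simp [R.apply₁₁, R.apply₁₂]) (fun q ↦ by simp [R.contract₁₁, R.contract₁₂]) Y p

/-- `L_Z α₂ = 0` for `Z = Z₁ + Z₂`. -/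
theorem mvfderiv_reeb₂ (S : IsMetricContactPair m n α₁ α₂ φ Z₁ Z₂) (Y : VecField I M) (p : M) :
    d% (fun q ↦ α₂ q (Y q)) p ((Z₁ + Z₂) p) = α₂ p (mlieBracket I (Z₁ + Z₂) Y p) := by
  have R := S.toContactPairStructure.reeb
  exact OneForm.mvfderiv_apply_of_contract (Z := Z₁ + Z₂) (c := 1)
    (fun q ↦ by simp [R.apply₂₁, R.apply₂₂]) (fun q ↦ by simp [R.contract₂₁, R.contract₂₂]) Y p

theorem map_eq_zero_imp (S : IsMetricContactPair m n α₁ α₂ φ Z₁ Z₂) {p : M}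
    {v : TangentSpace I p} (hv : φ p v = 0) (h₁ : α₁ p v = 0) (h₂ : α₂ p v = 0) : v = 0 := by
  have := S.sq p v
  simpa [hv, h₁, h₂] using this

theorem apply_map₁ (S : IsMetricContactPair m n α₁ α₂ φ Z₁ Z₂) (p : M)
    (v : TangentSpace I p) : α₁ p (φ p v) = 0 := by
  rw [← S.inner_reeb₁, S.inner_map_left, S.toContactPairStructure.map_reeb₁, inner_zero_right,
    neg_zero]

theorem apply_map₂ (S : IsMetricContactPair m n α₁ α₂ φ Z₁ Z₂) (p : M)
    (v : TangentSpace I p) : α₂ p (φ p v) = 0 := by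
  rw [← S.inner_reeb₂, S.inner_map_left, S.toContactPairStructure.map_reeb₂, inner_zero_right,
    neg_zero]

theorem map_map_map (S : IsMetricContactPair m n α₁ α₂ φ Z₁ Z₂) (p : M) (v : TangentSpace I p) :
    φ p (φ p (φ p v)) = -φ p v := by
  simp [S.sq p (φ p v), S.apply_map₁, S.apply_map₂]

theorem map_reeb (S : IsMetricContactPair m n α₁ α₂ φ Z₁ Z₂) (p : M) : φ p ((Z₁ + Z₂) p) = 0 := by
  simp [S.toContactPairStructure.map_reeb₁, S.toContactPairStructure.map_reeb₂]

variable [T2Space M] [SecondCountableTopology M]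

/-- The Reeb vector fields commute: `[Z₁, Z₂]` is annihilated by `α₁` and `α₂`, and also by `dα₁`
and `dα₂`, because `L_{Z₁} dαᵢ = 0`. -/
theorem mlieBracket_reeb (S : IsMetricContactPair m n α₁ α₂ φ Z₁ Z₂) (p : M) :
    mlieBracket I Z₁ Z₂ p = 0 := by
  have R := S.toContactPairStructure.reeb
  have e₁ := OneForm.mvfderiv_apply_of_contract R.apply₁₁ R.contract₁₁
  have e₂ := OneForm.mvfderiv_apply_of_contract R.apply₂₁ R.contract₂₁
  have a₁ : α₁ p (mlieBracket I Z₁ Z₂ p) = 0 := by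
    rw [← e₁, show (fun q ↦ α₁ q (Z₂ q)) = fun _ ↦ (0 : ℝ) from funext R.apply₁₂, mvfderiv_const]
    rfl
  have a₂ : α₂ p (mlieBracket I Z₁ Z₂ p) = 0 := by
    rw [← e₂, show (fun q ↦ α₂ q (Z₂ q)) = fun _ ↦ (1 : ℝ) from funext R.apply₂₂, mvfderiv_const]
    rfl
  refine S.map_eq_zero_imp ?_ a₁ a₂
  refine ext_inner_right ℝ fun w ↦ ?_
  obtain ⟨W, rfl⟩ := exists_vecField_apply_eq p w
  have d₁ := (OneForm.mvfderiv_d e₁ Z₂ W p).2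
  have d₂ := (OneForm.mvfderiv_d e₂ Z₂ W p).2
  simp only [R.contract₁₂, R.contract₂₂, zero_apply, mvfderiv_const, add_zero] at d₁ d₂
  rw [S.inner_map_left, S.inner_map, ← d₁, ← d₂]
  simp

theorem mlieBracket_reeb₁ (S : IsMetricContactPair m n α₁ α₂ φ Z₁ Z₂) (p : M) :
    mlieBracket I (Z₁ + Z₂) Z₁ p = 0 := by
  rw [ContMDiffSection.coe_add, mlieBracket_add_left (Z₁.mdifferentiableAt p)
    (Z₂.mdifferentiableAt p), mlieBracket_self, mlieBracket_swap_apply, S.mlieBracket_reeb]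
  simp

theorem mlieBracket_reeb₂ (S : IsMetricContactPair m n α₁ α₂ φ Z₁ Z₂) (p : M) :
    mlieBracket I (Z₁ + Z₂) Z₂ p = 0 := by
  rw [ContMDiffSection.coe_add, mlieBracket_add_left (Z₁.mdifferentiableAt p)
    (Z₂.mdifferentiableAt p), mlieBracket_self, S.mlieBracket_reeb]
  simp

end IsMetricContactPair

/-- The endomorphism `B = ∇Z + φ` of the tangent space at `p`. For a metric contact pair and the sum
`Z` of its Reeb vector fields, it is the symmetric part of `∇Z`. -/
def symmPart (φ : EndField I M) (Z : VecField I M) (p : M) :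
    TangentSpace I p →L[ℝ] TangentSpace I p :=
  leviCivita I M Z p + φ p

theorem leviCivita_eq_symmPart_sub (φ : EndField I M) (Z : VecField I M) (p : M)
    (v : TangentSpace I p) : leviCivita I M Z p v = symmPart φ Z p v - φ p v := by
  simp [symmPart]

namespace IsMetricContactPair

variable {m n : ℕ} {α₁ α₂ : OneForm I M} {φ : EndField I M} {Z₁ Z₂ : VecField I M}
variable [T2Space M] [SecondCountableTopology M]

/-- `B` is symmetric: by duality the antisymmetric part of `∇Z` is `dα₁ + dα₂`, which corresponds
to `-φ`. -/
theorem inner_symmPart_left (S : IsMetricContactPair m n α₁ α₂ φ Z₁ Z₂) (p : M)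
    (v w : TangentSpace I p) :
    inner ℝ (symmPart φ (Z₁ + Z₂) p v) w = inner ℝ v (symmPart φ (Z₁ + Z₂) p w) := by
  obtain ⟨X, rfl⟩ := exists_vecField_apply_eq p v
  obtain ⟨Y, rfl⟩ := exists_vecField_apply_eq p w
  have h₁ : ∀ V : VecField I M, symmPart φ (Z₁ + Z₂) p (V p)
      = leviCivita I M Z₁ p (V p) + leviCivita I M Z₂ p (V p) + φ p (V p) := by
    intro V
    simp [symmPart, (leviCivita I M).isCovariantDerivativeOnUniv.add
      (Z₁.mdifferentiableAt p) (Z₂.mdifferentiableAt p)]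
  have d₁ := inner_leviCivita_sub_of_dual S.inner_reeb₁ X Y p
  have d₂ := inner_leviCivita_sub_of_dual S.inner_reeb₂ X Y p
  have := S.inner_map p (X p) (Y p)
  rw [h₁, h₁]
  simp only [inner_add_left, inner_add_right, S.inner_map_left]
  linarith

/-- `2 g(B X, Y) = (L_Z g)(X, Y)`. -/
theorem two_mul_inner_symmPart (S : IsMetricContactPair m n α₁ α₂ φ Z₁ Z₂)
    (X Y : VecField I M) (p : M) :
    2 * inner ℝ (symmPart φ (Z₁ + Z₂) p (X p)) (Y p)
      = d% (fun q ↦ inner ℝ (X q) (Y q)) p ((Z₁ + Z₂) p)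
        - inner ℝ (mlieBracket I (Z₁ + Z₂) X p) (Y p)
        - inner ℝ (X p) (mlieBracket I (Z₁ + Z₂) Y p) := by
  have h := lieDeriv_inner (Z₁ + Z₂) X Y p
  have hs := S.inner_symmPart_left p (X p) (Y p)
  simp only [leviCivita_eq_symmPart_sub φ, inner_sub_left, inner_sub_right, S.inner_map_left] at h
  linarith

/-- `Z` is Killing if and only if `B = 0`. -/
theorem isKilling_iff (S : IsMetricContactPair m n α₁ α₂ φ Z₁ Z₂) :
    IsKilling (Z₁ + Z₂) ↔ ∀ p (v : TangentSpace I p), symmPart φ (Z₁ + Z₂) p v = 0 := by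
  constructor
  · intro h p v
    refine ext_inner_right ℝ fun w ↦ ?_
    obtain ⟨X, rfl⟩ := exists_vecField_apply_eq p v
    obtain ⟨Y, rfl⟩ := exists_vecField_apply_eq p w
    have h1 := h X Y p
    have h2 := S.two_mul_inner_symmPart X Y p
    rw [inner_zero_left]
    linarith
  · intro h X Y p
    have h2 := S.two_mul_inner_symmPart X Y p
    rw [h, inner_zero_left, mul_zero] at h2
    exact h2.symm

/-- `L_Z φ = -2 B φ`, from `L_Z (dα₁ + dα₂) = 0` and `L_Z g = 2 g(B ·, ·)`. -/
theorem mlieBracket_map (S : IsMetricContactPair m n α₁ α₂ φ Z₁ Z₂) (Y : VecField I M) (p : M) :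
    mlieBracket I (Z₁ + Z₂) (φ.app Y) p = φ p (mlieBracket I (Z₁ + Z₂) Y p)
      - (2 : ℝ) • symmPart φ (Z₁ + Z₂) p (φ p (Y p)) := by
  refine ext_inner_left ℝ fun w ↦ ?_
  obtain ⟨X, rfl⟩ := exists_vecField_apply_eq p w
  have h := S.two_mul_inner_symmPart X (φ.app Y) p
  obtain ⟨m₁, d₁⟩ := OneForm.mvfderiv_d (Z := Z₁ + Z₂) S.mvfderiv_reeb₁ X Y p
  obtain ⟨m₂, d₂⟩ := OneForm.mvfderiv_d (Z := Z₁ + Z₂) S.mvfderiv_reeb₂ X Y p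
  simp only [EndField.app_apply, S.inner_map] at h
  rw [mvfderiv_fun_add m₁ m₂, add_apply, d₁, d₂] at h
  rw [inner_sub_right, inner_smul_right, S.inner_map,
    ← S.inner_symmPart_left, S.inner_map]
  linarith

/-- `B` takes values orthogonal to `Z₁`, because `L_Z α₁ = 0` and `[Z, Z₁] = 0`. -/
theorem apply_symmPart₁ (S : IsMetricContactPair m n α₁ α₂ φ Z₁ Z₂) (p : M)
    (v : TangentSpace I p) : α₁ p (symmPart φ (Z₁ + Z₂) p v) = 0 := by
  obtain ⟨X, rfl⟩ := exists_vecField_apply_eq p v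
  have h := S.two_mul_inner_symmPart X Z₁ p
  simp only [S.inner_reeb₁, S.mvfderiv_reeb₁] at h
  rw [S.mlieBracket_reeb₁] at h
  simpa using h

/-- `B` takes values orthogonal to `Z₂`, because `L_Z α₂ = 0` and `[Z, Z₂] = 0`. -/
theorem apply_symmPart₂ (S : IsMetricContactPair m n α₁ α₂ φ Z₁ Z₂) (p : M)
    (v : TangentSpace I p) : α₂ p (symmPart φ (Z₁ + Z₂) p v) = 0 := by
  obtain ⟨X, rfl⟩ := exists_vecField_apply_eq p v
  have h := S.two_mul_inner_symmPart X Z₂ p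
  simp only [S.inner_reeb₂, S.mvfderiv_reeb₂] at h
  rw [S.mlieBracket_reeb₂] at h
  simpa using h

theorem symmPart_reeb₁ (S : IsMetricContactPair m n α₁ α₂ φ Z₁ Z₂) (p : M) :
    symmPart φ (Z₁ + Z₂) p (Z₁ p) = 0 :=
  ext_inner_left ℝ fun w ↦ by
    rw [← S.inner_symmPart_left, S.inner_reeb₁, S.apply_symmPart₁, inner_zero_right]

theorem symmPart_reeb₂ (S : IsMetricContactPair m n α₁ α₂ φ Z₁ Z₂) (p : M) :
    symmPart φ (Z₁ + Z₂) p (Z₂ p) = 0 :=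
  ext_inner_left ℝ fun w ↦ by
    rw [← S.inner_symmPart_left, S.inner_reeb₂, S.apply_symmPart₂, inner_zero_right]

theorem map_map_symmPart (S : IsMetricContactPair m n α₁ α₂ φ Z₁ Z₂) (p : M)
    (v : TangentSpace I p) :
    φ p (φ p (symmPart φ (Z₁ + Z₂) p v)) = -symmPart φ (Z₁ + Z₂) p v := by
  simp [S.sq, S.apply_symmPart₁, S.apply_symmPart₂]

theorem symmPart_map_map (S : IsMetricContactPair m n α₁ α₂ φ Z₁ Z₂) (p : M)
    (v : TangentSpace I p) :
    symmPart φ (Z₁ + Z₂) p (φ p (φ p v)) = -symmPart φ (Z₁ + Z₂) p v := by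
  simp only [S.sq, map_add, map_neg, map_smul, S.symmPart_reeb₁, S.symmPart_reeb₂, smul_zero,
    add_zero]

/-- `L_Z (φ²) = 0`, because `φ² = -Id + α₁ ⊗ Z₁ + α₂ ⊗ Z₂`. -/
theorem mlieBracket_map_map (S : IsMetricContactPair m n α₁ α₂ φ Z₁ Z₂) (X : VecField I M)
    (p : M) : mlieBracket I (Z₁ + Z₂) (φ.app (φ.app X)) p
      = φ p (φ p (mlieBracket I (Z₁ + Z₂) X p)) := by
  have e : ⇑(φ.app (φ.app X)) = (-1 : ℝ) • ⇑X + (fun q ↦ α₁ q (X q)) • ⇑Z₁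
      + (fun q ↦ α₂ q (X q)) • ⇑Z₂ := by
    ext q
    simp [S.sq]
  have m₀ := X.mdifferentiableAt p
  have m₁ := (α₁.mdifferentiableAt_vecField X p).smul_section (Z₁.mdifferentiableAt p)
  have m₂ := (α₂.mdifferentiableAt_vecField X p).smul_section (Z₂.mdifferentiableAt p)
  have m₀' : MDiffAt (T% ((-1 : ℝ) • (⇑X : Π q : M, TangentSpace I q))) p :=
    mdifferentiableAt_const.smul_section m₀
  have h₁ := S.mvfderiv_reeb₁ X p
  have h₂ := S.mvfderiv_reeb₂ X p
  rw [e, mlieBracket_add_right (mdifferentiableAt_add_section m₀' m₁) m₂,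
    mlieBracket_add_right m₀' m₁, mlieBracket_const_smul_right m₀,
    mlieBracket_smul_right (α₁.mdifferentiableAt_vecField X p) (Z₁.mdifferentiableAt p),
    mlieBracket_smul_right (α₂.mdifferentiableAt_vecField X p) (Z₂.mdifferentiableAt p),
    S.mlieBracket_reeb₁, S.mlieBracket_reeb₂, S.sq, h₁, h₂]
  simp

/-- `φ B φ = B`: expand `L_Z (φ²) = 0` with `L_Z φ = -2 B φ`. -/
theorem map_symmPart_map (S : IsMetricContactPair m n α₁ α₂ φ Z₁ Z₂) (p : M)
    (v : TangentSpace I p) :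
    φ p (symmPart φ (Z₁ + Z₂) p (φ p v)) = symmPart φ (Z₁ + Z₂) p v := by
  obtain ⟨X, rfl⟩ := exists_vecField_apply_eq p v
  have h := S.mlieBracket_map_map X p
  rw [S.mlieBracket_map, S.mlieBracket_map, EndField.app_apply, S.symmPart_map_map, map_sub,
    map_smul] at h
  have h' : (2 : ℝ) • φ p (symmPart φ (Z₁ + Z₂) p (φ p (X p)))
      = (2 : ℝ) • symmPart φ (Z₁ + Z₂) p (X p) := by
    rw [← sub_eq_zero] at h ⊢
    rw [← neg_eq_zero, ← h]
    module
  exact smul_right_injective _ two_ne_zero h'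

theorem map_symmPart (S : IsMetricContactPair m n α₁ α₂ φ Z₁ Z₂) (p : M) (v : TangentSpace I p) :
    φ p (symmPart φ (Z₁ + Z₂) p v) = -symmPart φ (Z₁ + Z₂) p (φ p v) := by
  rw [← S.map_symmPart_map p v, S.map_map_symmPart]

/-- The vector field `B X`. It is smooth because `2 B X = φ (φ [Z, X] - [Z, φ X])`. -/
theorem exists_vecField_symmPart (S : IsMetricContactPair m n α₁ α₂ φ Z₁ Z₂) (X : VecField I M) :
    ∃ Y : VecField I M, ∀ p, Y p = symmPart φ (Z₁ + Z₂) p (X p) := by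
  refine ⟨(1 / 2 : ℝ) • (φ.app (φ.app ((Z₁ + Z₂).bracket X))
    - φ.app ((Z₁ + Z₂).bracket (φ.app X))), fun p ↦ ?_⟩
  have h := S.mlieBracket_map X p
  rw [ContMDiffSection.coe_smul, Pi.smul_apply, ContMDiffSection.coe_sub, Pi.sub_apply]
  simp only [EndField.app_apply, VecField.bracket_apply, h]
  simp [S.map_symmPart_map]

/-! ### The Jacobi operator of the sum of the Reeb vector fields -/

/-- The integral curves of `Z` are geodesics. -/
theorem leviCivita_reeb (S : IsMetricContactPair m n α₁ α₂ φ Z₁ Z₂) (p : M) :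
    leviCivita I M (Z₁ + Z₂ : VecField I M) p ((Z₁ + Z₂) p) = 0 := by
  rw [leviCivita_eq_symmPart_sub φ, S.map_reeb, sub_zero]
  exact (map_add _ _ _).trans (by rw [S.symmPart_reeb₁, S.symmPart_reeb₂, add_zero])

/-- The Jacobi operator `R_{XZ} Z = -φ² X - B² X - 2 B φ X - (L_Z B) X`. The field `B X` enters as
a smooth vector field `Y`, so that its Lie bracket with `Z` is meaningful. -/
theorem curvature_reeb (S : IsMetricContactPair m n α₁ α₂ φ Z₁ Z₂) {X Y : VecField I M}
    (hY : ∀ p, Y p = symmPart φ (Z₁ + Z₂) p (X p)) (p : M) :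
    curvature X (Z₁ + Z₂) (Z₁ + Z₂) p = -φ p (φ p (X p))
      - symmPart φ (Z₁ + Z₂) p (symmPart φ (Z₁ + Z₂) p (X p))
      - (2 : ℝ) • symmPart φ (Z₁ + Z₂) p (φ p (X p))
      - (mlieBracket I (Z₁ + Z₂) Y p
        - symmPart φ (Z₁ + Z₂) p (mlieBracket I (Z₁ + Z₂) X p)) := by
  have e : ⇑(Y - φ.app X) = ⇑Y + (-1 : ℝ) • ⇑(φ.app X) := by
    ext q; simp [sub_eq_add_neg]
  have hm := (φ.app X).mdifferentiableAt p
  have hm' : MDiffAt (T% ((-1 : ℝ) • (⇑(φ.app X) : Π q : M, TangentSpace I q))) p :=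
    mdifferentiableAt_const.smul_section hm
  rw [curvature_eq_of_geodesic S.leviCivita_reeb (A := Y - φ.app X)
    (fun q ↦ by rw [leviCivita_eq_symmPart_sub φ, ← hY]; rfl), e,
    mlieBracket_add_right (Y.mdifferentiableAt p) hm', mlieBracket_const_smul_right hm,
    S.mlieBracket_map]
  simp only [leviCivita_eq_symmPart_sub φ, Pi.add_apply, Pi.smul_apply, EndField.app_apply,
    map_add, map_smul, hY, S.map_symmPart]
  module

/-- Conjugating the Jacobi operator by `φ` cancels `L_Z B`, the only term that is not algebraic
in `φ` and `B`. -/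
theorem curvature_reeb_sub_map (S : IsMetricContactPair m n α₁ α₂ φ Z₁ Z₂) (X : VecField I M)
    (p : M) :
    curvature X (Z₁ + Z₂) (Z₁ + Z₂) p - φ p (curvature (φ.app X) (Z₁ + Z₂) (Z₁ + Z₂) p)
      = -((2 : ℝ) • φ p (φ p (X p)))
        - (2 : ℝ) • symmPart φ (Z₁ + Z₂) p (symmPart φ (Z₁ + Z₂) p (X p)) := by
  obtain ⟨Y, hY⟩ := S.exists_vecField_symmPart X
  -- `B (φ X) = -φ (B X)`
  have hY' : ∀ q, ((-1 : ℝ) • φ.app Y) q = symmPart φ (Z₁ + Z₂) q (φ.app X q) := by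
    intro q
    simp [hY, S.map_symmPart]
  -- `αᵢ([Z, B X]) = Z(αᵢ(B X)) = 0`, so `φ²` acts on `[Z, B X]` as `-Id`.
  have hφφ : φ p (φ p (mlieBracket I (Z₁ + Z₂) Y p)) = -mlieBracket I (Z₁ + Z₂) Y p := by
    have h₁ := S.mvfderiv_reeb₁ Y p
    have h₂ := S.mvfderiv_reeb₂ Y p
    simp only [hY, S.apply_symmPart₁, S.apply_symmPart₂, mvfderiv_const, zero_apply] at h₁ h₂
    rw [S.sq, ← h₁, ← h₂, zero_smul, zero_smul, add_zero, add_zero]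
  rw [S.curvature_reeb hY, S.curvature_reeb hY', ContMDiffSection.coe_smul,
    mlieBracket_const_smul_right ((φ.app Y).mdifferentiableAt p), S.mlieBracket_map,
    S.mlieBracket_map]
  simp only [EndField.app_apply, hY, map_add, map_sub, map_neg, map_smul, S.map_symmPart, hφφ,
    S.map_map_map, S.symmPart_map_map, smul_neg, neg_neg, sub_neg_eq_add]
  module

theorem curvature_reeb_of_isKilling (S : IsMetricContactPair m n α₁ α₂ φ Z₁ Z₂)
    (hK : IsKilling (Z₁ + Z₂)) (Y : VecField I M) (p : M) :
    curvature Y (Z₁ + Z₂) (Z₁ + Z₂) p = Y p - α₁ p (Y p) • Z₁ p - α₂ p (Y p) • Z₂ p := by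
  have hB := S.isKilling_iff.1 hK
  rw [S.curvature_reeb (Y := 0) (fun q ↦ by simp [hB])]
  simp only [hB, S.sq, ContMDiffSection.coe_zero, mlieBracket_zero_right]
  simp
  abel

/-- The factor `2` is `g(Z, Z)`. -/
theorem sectionalCurvature_reeb (S : IsMetricContactPair m n α₁ α₂ φ Z₁ Z₂) {X : VecField I M}
    {p : M} (h₁ : α₁ p (X p) = 0) (h₂ : α₂ p (X p) = 0) :
    sectionalCurvature X (Z₁ + Z₂) p
      = inner ℝ (curvature X (Z₁ + Z₂) (Z₁ + Z₂) p) (X p) / (inner ℝ (X p) (X p) * 2) := by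
  have R := S.toContactPairStructure.reeb
  have e : inner ℝ ((Z₁ + Z₂) p) ((Z₁ + Z₂) p) = (2 : ℝ) := by
    rw [S.inner_reeb]
    simp [R.apply₁₁, R.apply₁₂, R.apply₂₁, R.apply₂₂]
    norm_num
  rw [sectionalCurvature, e, S.inner_reeb]
  simp [h₁, h₂]

end IsMetricContactPair

end Riemannian

end

theorem mainTheorem7
    {E : Type*} [NormedAddCommGroup E] [NormedSpace ℝ E] [FiniteDimensional ℝ E]
    {H : Type*} [TopologicalSpace H] {I : ModelWithCorners ℝ E H} [I.Boundaryless]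
    {M : Type*} [TopologicalSpace M] [ChartedSpace H M] [IsManifold I ∞ M]
    [T2Space M] [SecondCountableTopology M]
    [RiemannianBundle (fun p : M ↦ TangentSpace I p)]
    [IsContMDiffRiemannianBundle I ∞ E (fun p : M ↦ TangentSpace I p)]
    (h k : ℕ) (α₁ α₂ : OneForm I M) (φ : EndField I M) (Z₁ Z₂ : VecField I M)
    (hMCP : IsMetricContactPair h k α₁ α₂ φ Z₁ Z₂) (hφ : IsDecomposable α₁ α₂ φ) :
    (IsKilling (Z₁ + Z₂) ↔
      ∀ (X : VecField I M) (p : M), X p ≠ 0 → inner ℝ (X p) (Z₁ p) = 0 →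
        inner ℝ (X p) (Z₂ p) = 0 → sectionalCurvature X (Z₁ + Z₂) p = 1 / 2) ∧
    (IsKilling (Z₁ + Z₂) → ∀ (Y : VecField I M) (p : M),
      curvature Y (Z₁ + Z₂) (Z₁ + Z₂) p = Y p - α₁ p (Y p) • Z₁ p - α₂ p (Y p) • Z₂ p) := by
  refine ⟨⟨fun hK X p hX h₁ h₂ ↦ ?_, fun hK ↦ ?_⟩, hMCP.curvature_reeb_of_isKilling⟩
  · rw [hMCP.inner_reeb₁] at h₁
    rw [hMCP.inner_reeb₂] at h₂
    have h0 : inner ℝ (X p) (X p) ≠ 0 := inner_self_ne_zero.2 hX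
    rw [hMCP.sectionalCurvature_reeb h₁ h₂, hMCP.curvature_reeb_of_isKilling hK, h₁, h₂]
    simp only [zero_smul, sub_zero]
    field_simp
  · -- On the orthogonal complement of `Z₁`, `Z₂`, the hypothesis reads `g(R_{XZ} Z, X) = g(X, X)`.
    have key : ∀ (X : VecField I M) (p : M), α₁ p (X p) = 0 → α₂ p (X p) = 0 →
        inner ℝ (curvature X (Z₁ + Z₂) (Z₁ + Z₂) p) (X p) = inner ℝ (X p) (X p) := by
      intro X p h₁ h₂
      by_cases hX : X p = 0
      · simp [hX]
      have h0 : inner ℝ (X p) (X p) ≠ 0 := inner_self_ne_zero.2 hX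
      have := hK X p hX (by rw [hMCP.inner_reeb₁, h₁]) (by rw [hMCP.inner_reeb₂, h₂])
      rw [hMCP.sectionalCurvature_reeb h₁ h₂] at this
      field_simp at this
      linarith
    rw [hMCP.isKilling_iff]
    have hφv : ∀ (p : M) (v : TangentSpace I p), symmPart φ (Z₁ + Z₂) p (φ p v) = 0 := by
      intro p v
      obtain ⟨W, rfl⟩ := exists_vecField_apply_eq p v
      have k₁ := key (φ.app W) p (hMCP.apply_map₁ p _) (hMCP.apply_map₂ p _)
      have k₂ := key (φ.app (φ.app W)) p (hMCP.apply_map₁ p _) (hMCP.apply_map₂ p _)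
      -- Pair `ℓ X - φ ℓ φ X = -2 φ² X - 2 B² X` with `X = φ W`: by `key` the left-hand side and the
      -- first term on the right both give `2 |X|²`, which leaves `|B X|² = 0`.
      have hc := congrArg (fun u ↦ inner ℝ u (φ.app W p))
        (hMCP.curvature_reeb_sub_map (φ.app W) p)
      simp only [EndField.app_apply, inner_sub_left, inner_neg_left, inner_smul_left,
        hMCP.inner_map_left, hMCP.inner_symmPart_left, hMCP.map_map_map, map_neg,
        inner_neg_right, conj_trivial] at hc k₁ k₂
      rw [← inner_self_eq_zero (𝕜 := ℝ), hMCP.inner_symmPart_left, hMCP.inner_map_left]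
      linarith
    -- `B = -B φ²`, so it suffices that `B` vanishes on the image of `φ`.
    intro p v
    rw [← neg_neg v, ← neg_eq_zero, ← hMCP.symmPart_map_map, hφv]
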